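/- Consider two agents and a finite set $M$ of $m$ indivisible items. A valuation is additive and given by nonnegative item values, $v(S)=\sum_{j\in S}v(j)$, and its maximin share is $\mu(v)=\max_{S_1\sqcup S_2=M}\min\{v(S_1),v(S_2)\}$. A learning-augmented mechanism with prediction space $\mathcal P$ (an arbitrary set) maps every pair of reported valuations $\mathbf r=(r_1,r_2)$ and every prediction $p\in\mathcal P$ to a partition $X(\mathbf r,p)=(X_1(\mathbf r,p),X_2(\mathbf r,p))$ of $M$. It is truthful if, for every prediction and every report of the other agent, no agent can increase the true value of the bundle she receives by misreporting her valuation. For $\alpha>0$ and a prediction function $f$ from valuation profiles to $\mathcal P$, it is $\alpha$-consistent with respect to $f$ if $v_i(X_i(\mathbf v,f(\mathbf v)))\ge\mu(v_i)/\alpha$ for all profiles $\mathbf v=(v_1,v_2)$ and $i=1,2$. For $\beta>0$, it is $\beta$-robust if $v_i(X_i(\mathbf v,p))\ge\mu(v_i)/\beta$ for all profiles $\mathbf v$, all $p\in\mathcal P$ and $i=1,2$; it has bounded robustness if it is $\beta$-robust for some finite $\beta$. **Theorem.** (1) Let $m\ge 5$, and let $\mathcal P$ be any prediction space and $f$ any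 prediction function. For every $\epsilon$ with $0<\epsilon<6/5$, no truthful learning-augmented mechanism for two agents and $m$ items is $(6/5-\epsilon)$-consistent with respect to $f$ and has bounded robustness. (2) Let $m=5$ and let both agents have the valuation $v=(1/2,1/2,1/3,1/3,1/3)$. Then $\mu(v)=1$, and for every truthful mechanism with bounded robustness and every prediction $p$, the allocation $X((v,v),p)$ gives exactly one of the two items of value $1/2$ to each agent, so that some agent receives a bundle of value at most $5/6$. -/

import Mathlib

open scoped NNReal

noncomputable section

namespace MMS

/-- An additive valuation over the finite set `M` of indivisible goods, given by the
(nonnegative) values of the single items. -/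
abbrev Valuation (M : Type*) := M → ℝ≥0

/-- A valuation profile (or a report profile) of `n` agents. -/
abbrev Profile (n : ℕ) (M : Type*) := Fin n → Valuation M

/-- An ordered partition of `M` into `n` (possibly empty) bundles, encoded by the map
that sends an item to the index of its bundle. -/
abbrev Allocation (n : ℕ) (M : Type*) := M → Fin n

variable {n : ℕ} {M P : Type*} [Fintype M]

/-- The `i`-th bundle of an allocation. -/
def bundle (A : Allocation n M) (i : Fin n) : Finset M :=
  Finset.univ.filter fun j => A j = i

/-- The value `v(S)` of a bundle `S` under the additive valuation `v`. -/
def value (v : Valuation M) (S : Finset M) : ℝ :=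
  ∑ j ∈ S, (v j : ℝ)

/-- The maximin share `μ^k` of a valuation: the maximum over all partitions of `M` into `k`
bundles of the minimum value of a bundle (for `k ≥ 1` both extrema are over finite nonempty
sets, hence attained). -/
def mms (k : ℕ) (v : Valuation M) : ℝ :=
  ⨆ S : Allocation k M, ⨅ j : Fin k, value v (bundle S j)

/-- `(γ, k)`-approximate MMS allocation: `v_i(X_i) ≥ μ_i^k / γ` for every agent `i`.
The factor is only required to be positive, so that exact MMS allocations (`γ = 1`)
are included. -/
def IsApproxMMS (γ : ℝ) (k : ℕ) (v : Profile n M) (A : Allocation n M) : Prop :=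
  0 < γ ∧ ∀ i, mms k (v i) / γ ≤ value (v i) (bundle A i)

variable (n M P) in
/-- A learning-augmented mechanism with prediction space `P`: it maps the agents' reports and
a prediction to a partition of the items among the agents. -/
abbrev Mechanism := Profile n M → P → Allocation n M

/-- Truthfulness: whatever the prediction and the other agents' reports are, an agent with
valuation `vi` does not gain by reporting some `ri` instead. -/
def Truthful (X : Mechanism n M P) : Prop :=
  ∀ (i : Fin n) (r : Profile n M) (p : P) (vi ri : Valuation M),
    value vi (bundle (X (Function.update r i ri) p) i) ≤
      value vi (bundle (X (Function.update r i vi) p) i)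

/-- `α`-consistency with respect to the prediction function `f`. -/
def Consistent (X : Mechanism n M P) (f : Profile n M → P) (α : ℝ) : Prop :=
  ∀ v : Profile n M, IsApproxMMS α n v (X v (f v))

/-- `(β, k)`-robustness. -/
def Robust (X : Mechanism n M P) (β : ℝ) (k : ℕ) : Prop :=
  ∀ (v : Profile n M) (p : P), IsApproxMMS β k v (X v p)

/-- The mechanism is `β`-robust (i.e. `(β, n)`-robust) for some finite `β`. -/
def BoundedRobustness (X : Mechanism n M P) : Prop :=
  ∃ β : ℝ, Robust X β n

/-- The valuation `(1/2, 1/2, 1/3, 1/3, 1/3)` on five items; items `0` and `1` are large. -/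
def witness : Valuation (Fin 5) := ![1/2, 1/2, 1/3, 1/3, 1/3]

end MMS

end

set_option linter.unusedSectionVars false

namespace MMS

variable {M : Type*} [Fintype M]

/-! ### Values of bundles -/

/-! Fix the prediction, so that a mechanism is a truthful division between two agents. Each item is
controlled by one of them: if both report to value only `x`, then by truthfulness the agent who gets
`x` then gets it whenever she strongly desires it (`controls_or_controls_swap`). At positive reports
nobody receives two items that she controls (`not_mem_of_controls`). Otherwise she could inflate
both without changing her bundle, and would then keep both against every report of the other agent,
even one worth nothing outside this pair, against robustness. Hence two items that the second agent
ranks above all others cannot both go to the first (`not_both_mem`). If the first controls both,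
this is the previous claim. Otherwise the second controls one of them, say `b`; claiming `b` costs
her at most one less valuable item, unless the first agent herself has a profitable misreport. On
the critical instance the items of value 1/2 are therefore split, and the agent with at most one of
the three others gets at most 5/6. Padding with items of tiny value covers larger `m`. -/

lemma value_mono (u : Valuation M) {S T : Finset M} (h : S ⊆ T) : value u S ≤ value u T :=
  Finset.sum_le_sum_of_subset_of_nonneg h fun _ _ _ => NNReal.coe_nonneg _

lemma le_value_of_mem (u : Valuation M) {S : Finset M} {x : M} (h : x ∈ S) :
    (u x : ℝ) ≤ value u S :=
  Finset.single_le_sum (f := fun j => (u j : ℝ)) (fun _ _ => NNReal.coe_nonneg _) h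

variable [DecidableEq M]

lemma value_insert (u : Valuation M) {S : Finset M} {x : M} (h : x ∉ S) :
    value u (insert x S) = u x + value u S :=
  Finset.sum_insert h

lemma value_add_value_compl (u : Valuation M) (S : Finset M) :
    value u S + value u Sᶜ = ∑ j, (u j : ℝ) :=
  Finset.sum_add_sum_compl S _

/-- A valuation strongly desires an item if it is worth more than all other items together. -/
def StronglyDesires (u : Valuation M) (x : M) : Prop :=
  value u {x}ᶜ < u x

lemma StronglyDesires.mem_of_value_le {u : Valuation M} {x : M} (h : StronglyDesires u x)
    {S T : Finset M} (hS : x ∈ S) (hST : value u S ≤ value u T) : x ∈ T := by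
  by_contra hT
  have h1 : value u T ≤ value u {x}ᶜ :=
    value_mono u fun j hj => by
      simp only [Finset.mem_compl, Finset.mem_singleton]
      rintro rfl
      exact hT hj
  have h2 := le_value_of_mem u hS
  unfold StronglyDesires at h
  linarith

/-- If passing from `u` to `u'` raises the items of `S` and lowers the other ones, then a bundle
that is not better than `S` for `u` and not worse than `S` for `u'` equals `S`. -/
lemma eq_of_value_le {u u' : Valuation M} {S T : Finset M} (h : value u T ≤ value u S)
    (h' : value u' S ≤ value u' T) (hup : ∀ j ∈ S, j ∉ T → u j < u' j)
    (hdown : ∀ j ∈ T, j ∉ S → u' j < u j) : T = S := by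
  have split (w : Valuation M) (P Q : Finset M) :
      value w P = value w (P ∩ Q) + value w (P \ Q) :=
    (Finset.sum_inter_add_sum_sdiff P Q _).symm
  have e1 := split u T S
  have e2 := split u S T
  have e3 := split u' T S
  have e4 := split u' S T
  rw [Finset.inter_comm S T] at e2 e4
  have l1 : value u (S \ T) ≤ value u' (S \ T) := Finset.sum_le_sum fun j hj => by
    rw [Finset.mem_sdiff] at hj
    exact_mod_cast (hup j hj.1 hj.2).le
  have l2 : value u' (T \ S) ≤ value u (T \ S) := Finset.sum_le_sum fun j hj => by
    rw [Finset.mem_sdiff] at hj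
    exact_mod_cast (hdown j hj.1 hj.2).le
  apply Finset.Subset.antisymm
  · by_contra hne
    have : value u' (T \ S) < value u (T \ S) :=
      Finset.sum_lt_sum_of_nonempty (Finset.sdiff_nonempty.2 hne) fun j hj => by
        rw [Finset.mem_sdiff] at hj
        exact_mod_cast hdown j hj.1 hj.2
    linarith
  · by_contra hne
    have : value u (S \ T) < value u' (S \ T) :=
      Finset.sum_lt_sum_of_nonempty (Finset.sdiff_nonempty.2 hne) fun j hj => by
        rw [Finset.mem_sdiff] at hj
        exact_mod_cast hup j hj.1 hj.2
    linarith

/-- Raise the items of `S`, lower the other ones, and make `x` worth more than everything else. -/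
noncomputable def focus (S : Finset M) (u : Valuation M) (x : M) : Valuation M := fun j =>
  if j = x then ∑ k, (u k + 1) else if j ∈ S then u j + 1 else u j / 2

section focus

variable {S : Finset M} {u : Valuation M} {x : M}

lemma lt_sum_add_one (u : Valuation M) (x : M) : u x < ∑ k, (u k + 1) :=
  (lt_add_of_pos_right _ one_pos).trans_le
    (Finset.single_le_sum (f := fun k => u k + 1) (fun _ _ => zero_le) (Finset.mem_univ x))

lemma lt_focus {j : M} (hj : j ∈ S) : u j < focus S u x j := by
  unfold focus
  split_ifs with h
  · exact lt_sum_add_one u j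
  · exact lt_add_of_pos_right _ one_pos

lemma focus_lt (hu : ∀ j, 0 < u j) {j : M} (hj : j ∉ S) (hx : j ≠ x) : focus S u x j < u j := by
  simp only [focus, hx, hj, if_false]
  exact NNReal.half_lt_self (hu j).ne'

lemma focus_pos (hu : ∀ j, 0 < u j) (j : M) : 0 < focus S u x j := by
  unfold focus
  split_ifs
  · exact (hu j).trans (lt_sum_add_one u j)
  · exact (hu j).trans (lt_add_of_pos_right _ one_pos)
  · exact half_pos (hu j)

lemma focus_stronglyDesires : StronglyDesires (focus S u x) x := by
  have h1 : value (focus S u x) {x}ᶜ ≤ ∑ j ∈ ({x}ᶜ : Finset M), ((u j : ℝ) + 1) :=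
    Finset.sum_le_sum fun j hj => by
      have hjx : j ≠ x := by simpa using hj
      have := NNReal.coe_nonneg (u j)
      simp only [focus, hjx, if_false]
      split_ifs
      · push_cast; rfl
      · push_cast; linarith
  have h2 : (focus S u x x : ℝ) = ∑ j, ((u j : ℝ) + 1) := by simp [focus]
  have h3 := Finset.sum_add_sum_compl ({x} : Finset M) fun j => ((u j : ℝ) + 1)
  rw [Finset.sum_singleton] at h3
  have := NNReal.coe_nonneg (u x)
  unfold StronglyDesires
  linarith

end focus

/-! ### Truthful divisions between two agents -/

/-- `A u v` is the bundle of the first agent when the reports are `u` and `v`; the second agent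
gets the complement. Both agents are truthful, and an agent for whom two items outweigh the rest
by the factor `β` gets at least one of them. -/
structure IsRobustDivision (β : ℝ≥0) (A : Valuation M → Valuation M → Finset M) : Prop where
  truth : ∀ u u' v, value u (A u' v) ≤ value u (A u v)
  truth_compl : ∀ u v v', value v (A u v')ᶜ ≤ value v (A u v)ᶜ
  robust : ∀ u v x y, x ≠ y → ∀ t : ℝ≥0, t ≤ u x → t ≤ u y → β * value u {x, y}ᶜ < t →
    x ∈ A u v ∨ y ∈ A u v
  robust_compl : ∀ u v x y, x ≠ y → ∀ t : ℝ≥0, t ≤ v x → t ≤ v y → β * value v {x, y}ᶜ < t →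
    x ∉ A u v ∨ y ∉ A u v

/-- The first agent gets `x` whenever she strongly desires it. -/
def Controls (A : Valuation M → Valuation M → Finset M) (x : M) : Prop :=
  ∀ u v, StronglyDesires u x → x ∈ A u v

/-- The same division with the roles of the two agents exchanged. -/
def swapAgents (A : Valuation M → Valuation M → Finset M) :
    Valuation M → Valuation M → Finset M :=
  fun v u => (A u v)ᶜ

namespace IsRobustDivision

variable {β : ℝ≥0} {A : Valuation M → Valuation M → Finset M}

lemma swap (h : IsRobustDivision β A) : IsRobustDivision β (swapAgents A) where
  truth v v' u := h.truth_compl u v v'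
  truth_compl v u u' := by simpa [swapAgents] using h.truth u u' v
  robust v u x y := by simpa [swapAgents] using h.robust_compl u v x y
  robust_compl v u x y := by simpa [swapAgents] using h.robust u v x y

lemma controls_or_controls_swap (h : IsRobustDivision β A) (x : M) :
    Controls A x ∨ Controls (swapAgents A) x := by
  have key : ∀ {B : Valuation M → Valuation M → Finset M}, IsRobustDivision β B →
      x ∈ B (Pi.single x 1) (Pi.single x 1) → Controls B x := by
    intro B hB hx u v hu
    have hd : StronglyDesires (Pi.single x 1 : Valuation M) x := by
      have : value (Pi.single x 1 : Valuation M) {x}ᶜ = 0 :=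
        Finset.sum_eq_zero fun j hj => by
          have hjx : j ≠ x := by simpa using hj
          simp [hjx]
      simp [StronglyDesires, this]
    have h1 : x ∈ B (Pi.single x 1) v := by
      by_contra hv
      have := hd.mem_of_value_le (Finset.mem_compl.2 hv)
        (hB.truth_compl (Pi.single x 1) (Pi.single x 1) v)
      exact Finset.mem_compl.1 this hx
    exact hu.mem_of_value_le h1 (hB.truth _ _ _)
  by_cases hx : x ∈ A (Pi.single x 1) (Pi.single x 1)
  · exact .inl (key h hx)
  · exact .inr (key h.swap (Finset.mem_compl.2 hx))

/-- Allows an agent to be made to strongly desire an item she already receives without changing the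
division. -/
lemma focus_eq (h : IsRobustDivision β A) {u v : Valuation M} (hu : ∀ j, 0 < u j) {x : M}
    (hx : x ∈ A u v) : A (focus (A u v) u x) v = A u v :=
  eq_of_value_le (h.truth _ _ _) (h.truth _ _ _) (fun _ hj _ => lt_focus hj)
    fun j _ hj => focus_lt hu hj (by rintro rfl; exact hj hx)

/-- If the first agent gets two items, equally worth to her and each worth more than all the
remaining ones, and she controls one of them, then she gets this one whatever the other agent
reports. -/
lemma mem_of_controls_of_large (h : IsRobustDivision β A) {u v : Valuation M}
    (hu : ∀ j, 0 < u j) (hv : ∀ j, 0 < v j) {x y : M} (hxy : x ≠ y) (hx : x ∈ A u v)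
    (hy : y ∈ A u v) (hcx : Controls A x) (heq : u x = u y) (hbig : value u {x, y}ᶜ < u x)
    (w : Valuation M) : x ∈ A u w := by
  by_contra hw
  set S := A u v
  set v' := focus Sᶜ v x
  have hv' : x ∉ A u v' := Finset.mem_compl.1 <|
    focus_stronglyDesires.mem_of_value_le (Finset.mem_compl.2 hw) (h.truth_compl u v' w)
  set u' := focus S u x
  have hu'v : A u' v = S := h.focus_eq hu hx
  have hxT : x ∈ A u' v' := hcx _ _ focus_stronglyDesires
  -- The second agent misses `x` at `(u', v')`, so the huge value of `x` in `v'` plays no role: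
  -- among the items that matter, `v'` raises those of `Sᶜ` and lowers the others.
  have hT : (A u' v')ᶜ = Sᶜ := by
    have h1 := h.truth_compl u' v v'
    have h2 := h.truth_compl u' v' v
    rw [hu'v] at h1 h2
    refine eq_of_value_le h1 h2 (fun _ hj _ => lt_focus hj) fun j hjT hj => focus_lt hv hj ?_
    rintro rfl
    exact Finset.mem_compl.1 hjT hxT
  -- Against `v'`, reporting `u'` brings back `S` with both large items, while the honest report `u`
  -- loses `x`.
  have h3 := h.truth u u' v'
  rw [compl_injective hT] at h3
  have h4 : (u x : ℝ) + u y ≤ value u S := by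
    rw [← Finset.sum_pair (f := fun j => (u j : ℝ)) hxy]
    exact value_mono u (by simp [Finset.insert_subset_iff, hx, hy])
  have h5 : value u (A u v') ≤ u y + value u {x, y}ᶜ := by
    rw [← value_insert u (by simp)]
    refine value_mono u fun j hj => ?_
    have : j ≠ x := by rintro rfl; exact hv' hj
    simp only [Finset.mem_insert, Finset.mem_compl, Finset.mem_singleton]
    tauto
  linarith

/-- Both items are raised to a common huge value, so that `mem_of_controls_of_large` applies to each
of them and robustness fails for the other agent. -/
lemma not_mem_of_controls (h : IsRobustDivision β A) {u v : Valuation M}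
    (hu : ∀ j, 0 < u j) (hv : ∀ j, 0 < v j) {x y : M} (hxy : x ≠ y) (hcx : Controls A x)
    (hcy : Controls A y) (hx : x ∈ A u v) : y ∉ A u v := by
  intro hy
  set S := A u v
  -- Any value at least `∑ k, (u k + 1)` would serve.
  set H : ℝ≥0 := (1 + β) * ∑ k, (u k + 1)
  set u' : Valuation M := fun j => if j = x ∨ j = y then H else focus S u x j with hu'
  have hlt (j : M) : u j < H := (lt_sum_add_one u j).trans_le <|
    le_mul_of_one_le_left zero_le (le_add_of_nonneg_right zero_le)
  have hpos (j : M) : 0 < u' j := by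
    simp only [hu']
    split_ifs
    · exact zero_le.trans_lt (hlt j)
    · exact focus_pos hu j
  have hu'v : A u' v = S := by
    refine eq_of_value_le (h.truth _ _ _) (h.truth _ _ _) (fun j hj _ => ?_) fun j _ hj => ?_
    · simp only [hu']
      split_ifs
      · exact hlt j
      · exact lt_focus hj
    · have hjx : j ≠ x := by rintro rfl; exact hj hx
      have hjy : j ≠ y := by rintro rfl; exact hj hy
      simp only [hu', hjx, hjy, or_self, if_false]
      exact focus_lt hu hj hjx
  have ex : u' x = H := by simp [hu']
  have ey : u' y = H := by simp [hu']
  have hbig : value u' {x, y}ᶜ < H := by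
    have h1 : value u' {x, y}ᶜ ≤ value (focus S u x) {x}ᶜ := by
      have : value u' {x, y}ᶜ = value (focus S u x) {x, y}ᶜ :=
        Finset.sum_congr rfl fun j hj => by
          simp only [Finset.mem_compl, Finset.mem_insert, Finset.mem_singleton] at hj
          simp only [hu', hj, if_false]
      rw [this]
      exact value_mono _ (Finset.compl_subset_compl.2 (by simp))
    have h2 : value (focus S u x) {x}ᶜ < focus S u x x := focus_stronglyDesires
    have h3 : focus S u x x ≤ H := by
      simp only [focus, if_true]
      exact le_mul_of_one_le_left zero_le (le_add_of_nonneg_right zero_le)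
    exact h1.trans_lt (h2.trans_le (by exact_mod_cast h3))
  set w : Valuation M := fun j => if j = x ∨ j = y then 1 else 0 with hw
  have hxw : x ∈ A u' w :=
    h.mem_of_controls_of_large hpos hv hxy (by rwa [hu'v]) (by rwa [hu'v]) hcx
      (ex.trans ey.symm) (by rwa [ex]) w
  have hyw : y ∈ A u' w :=
    h.mem_of_controls_of_large hpos hv hxy.symm (by rwa [hu'v]) (by rwa [hu'v]) hcy
      (ey.trans ex.symm) (by rwa [ey, Finset.pair_comm]) w
  have hw0 : value w {x, y}ᶜ = 0 := Finset.sum_eq_zero fun j hj => by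
    simp only [Finset.mem_compl, Finset.mem_insert, Finset.mem_singleton] at hj
    simp [hw, hj]
  rcases h.robust_compl u' w x y hxy 1 (by simp [hw]) (by simp [hw])
      (by rw [hw0]; simp) with h1 | h1
  · exact h1 hxw
  · exact h1 hyw

/-- If the second agent controls `b` and values it above every item other than `a` and `b`, then
the first agent does not get both. -/
lemma not_both_mem_of_controls (h : IsRobustDivision β A) {u v : Valuation M}
    (hu : ∀ j, 0 < u j) (hv : ∀ j, 0 < v j) {a b : M} (ha : a ∈ A u v) (hb : b ∈ A u v)
    (hvb : ∀ j, j ≠ a → j ≠ b → v j < v b)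
    (hcb : Controls (swapAgents A) b) : False := by
  set S := A u v
  have hCC {u v : Valuation M} (hu : ∀ j, 0 < u j) (hv : ∀ j, 0 < v j) {x y : M}
      (hx : x ∈ A u v) (hy : y ∈ A u v) (hcx : Controls A x) (hcy : Controls A y) : y = x := by
    by_contra hne
    exact h.not_mem_of_controls hu hv (Ne.symm hne) hcx hcy hx hy
  have hDD {u v : Valuation M} (hu : ∀ j, 0 < u j) (hv : ∀ j, 0 < v j) {x y : M}
      (hx : x ∉ A u v) (hy : y ∉ A u v) (hcx : ¬ Controls A x) (hcy : ¬ Controls A y) :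
      y = x := by
    by_contra hne
    have := h.swap.not_mem_of_controls hv hu (Ne.symm hne)
      ((h.controls_or_controls_swap x).resolve_left hcx)
      ((h.controls_or_controls_swap y).resolve_left hcy) (Finset.mem_compl.2 hx)
    exact this (Finset.mem_compl.2 hy)
  have hne {j : M} (hj : j ∉ S) : v j < v b :=
    hvb j (by rintro rfl; exact hj ha) (by rintro rfl; exact hj hb)
  set v' := focus Sᶜ v b
  have hv' : ∀ j, 0 < v' j := focus_pos hv
  have hbv' (u : Valuation M) : b ∉ A u v' :=
    Finset.mem_compl.1 (hcb v' u focus_stronglyDesires)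
  -- replacing one item of the second agent's bundle by `b` would be profitable for her
  have gain {u' : Valuation M} (hu'v : A u' v = S) (z : M) (hz : z ∉ S)
      (hsub : ∀ j ∉ S, j ≠ z → j ∉ A u' v') : False := by
    have h1 := h.truth_compl u' v v'
    rw [hu'v] at h1
    have h2 : value v (insert b (Sᶜ.erase z)) ≤ value v (A u' v')ᶜ :=
      value_mono v fun j hj => by
        rw [Finset.mem_insert, Finset.mem_erase, Finset.mem_compl] at hj
        rw [Finset.mem_compl]
        rcases hj with rfl | ⟨hjz, hj⟩
        · exact hbv' u'
        · exact hsub j hj hjz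
    rw [value_insert v (by simp [hb])] at h2
    have h3 : value v Sᶜ = v z + value v (Sᶜ.erase z) := by
      rw [← value_insert v (by simp), Finset.insert_erase (by simpa using hz)]
    have h4 : (v z : ℝ) < v b := by exact_mod_cast hne hz
    linarith
  have gain' {u' : Valuation M} (hu'v : A u' v = S)
      (hsub : ∀ j ∉ S, j ∉ A u' v') : False := by
    have h1 := h.truth_compl u' v v'
    rw [hu'v] at h1
    have h2 : value v (insert b Sᶜ) ≤ value v (A u' v')ᶜ :=
      value_mono v fun j hj => by
        rw [Finset.mem_insert, Finset.mem_compl] at hj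
        rw [Finset.mem_compl]
        rcases hj with rfl | hj
        · exact hbv' u'
        · exact hsub j hj
    rw [value_insert v (by simp [hb])] at h2
    have h4 : (0 : ℝ) < v b := by exact_mod_cast hv b
    linarith
  -- If the first agent is made to insist on a controlled `x ∈ S`, she can take no other controlled
  -- item, and `Sᶜ` has at most one uncontrolled item `z` to lose.
  by_cases hx : ∃ x ∈ S, Controls A x
  · obtain ⟨x, hxS, hcx⟩ := hx
    set u' := focus S u x
    have hu' : ∀ j, 0 < u' j := focus_pos hu
    have hu'v : A u' v = S := h.focus_eq hu hxS
    have hxT : x ∈ A u' v' := hcx _ _ focus_stronglyDesires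
    have hC (j : M) (hj : j ∉ S) (hcj : Controls A j) : j ∉ A u' v' := fun hjT => by
      have := hCC hu' hv' hxT hjT hcx hcj
      subst this
      exact hj hxS
    by_cases hz : ∃ z ∉ S, ¬ Controls A z
    · obtain ⟨z, hzS, hcz⟩ := hz
      refine gain hu'v z hzS fun j hj hjz => hC j hj ?_
      by_contra hcj
      exact hjz (hDD hu hv hzS hj hcz hcj)
    · push Not at hz
      exact gain' hu'v fun j hj => hC j hj (hz j hj)
  · push Not at hx
    by_cases hz : ∃ z ∉ S, ¬ Controls A z
    · obtain ⟨z, hzS, hcz⟩ := hz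
      -- Here the first agent controls nothing in `S`. If she controls some `w`, it lies in `Sᶜ`;
      -- once the second agent insists on `z`, she can keep nothing of `S`, so claiming `w` gives
      -- the first agent `S` and `w`. If she controls nothing at all, then `Sᶜ` is just `{z}`.
      by_cases hw : ∃ w, Controls A w
      · obtain ⟨w, hcw⟩ := hw
        have hwS : w ∉ S := fun hw => hx w hw hcw
        set v₁ := focus Sᶜ v z
        have hv₁ : ∀ j, 0 < v₁ j := focus_pos hv
        have hSv₁ : A u v₁ = S := compl_injective (h.swap.focus_eq hv (Finset.mem_compl.2 hzS))
        set u₁ := focus S u w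
        have hu₁ : ∀ j, 0 < u₁ j := focus_pos hu
        have hzT : z ∉ A u₁ v₁ := Finset.mem_compl.1 <|
          (h.controls_or_controls_swap z).resolve_left hcz v₁ u₁ focus_stronglyDesires
        have h1 := h.truth u u₁ v₁
        rw [hSv₁] at h1
        have h2 : value u (insert w S) ≤ value u (A u₁ v₁) := value_mono u fun j hj => by
          rcases Finset.mem_insert.1 hj with rfl | hj
          · exact hcw _ _ focus_stronglyDesires
          · by_contra hjT
            have := hDD hu₁ hv₁ hzT hjT hcz (hx j hj)
            subst this
            exact hzS hj
        rw [value_insert u hwS] at h2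
        have h3 : (0 : ℝ) < u w := by exact_mod_cast hu w
        linarith
      · push Not at hw
        refine gain rfl z hzS fun j hj hjz => ?_
        exact absurd (hDD hu hv hzS hj hcz (hw j)) hjz
    · push Not at hz
      -- All of `Sᶜ` is now controlled by the first agent, who can take at most one item of it.
      by_cases hw : ∃ w ∉ S, w ∈ A u v'
      · obtain ⟨w, hwS, hwT⟩ := hw
        refine gain rfl w hwS fun j hj hjw hjT => hjw ?_
        exact hCC hu hv' hwT hjT (hz w hwS) (hz j hj)
      · push Not at hw
        exact gain' rfl hw

/-- If the second agent values `a` and `b` above all other items, then the first agent does not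
get both. -/
lemma not_both_mem (h : IsRobustDivision β A) {u v : Valuation M}
    (hu : ∀ j, 0 < u j) (hv : ∀ j, 0 < v j) {a b : M} (hab : a ≠ b)
    (hva : ∀ j, j ≠ a → j ≠ b → v j < v a) (hvb : ∀ j, j ≠ a → j ≠ b → v j < v b)
    (ha : a ∈ A u v) (hb : b ∈ A u v) : False := by
  by_cases hca : Controls A a
  · by_cases hcb : Controls A b
    · exact h.not_mem_of_controls hu hv hab hca hcb ha hb
    · exact h.not_both_mem_of_controls hu hv ha hb hvb
        ((h.controls_or_controls_swap b).resolve_left hcb)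
  · exact h.not_both_mem_of_controls hu hv hb ha (fun j h1 h2 => hva j h2 h1)
      ((h.controls_or_controls_swap a).resolve_left hca)

end IsRobustDivision

/-! ### Mechanisms -/

lemma le_mms {k : ℕ} [NeZero k] (v : Valuation M) {t : ℝ} (S : Allocation k M)
    (h : ∀ i, t ≤ value v (bundle S i)) : t ≤ mms k v :=
  (le_ciInf h).trans (le_ciSup (f := fun S : Allocation k M => ⨅ j, value v (bundle S j))
    (Set.finite_range _).bddAbove S)

lemma le_mms_of_two_items (v : Valuation M) {x y : M} (hxy : x ≠ y) {t : ℝ} (hx : t ≤ v x)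
    (hy : t ≤ v y) : t ≤ mms 2 v := by
  refine le_mms v (fun j => if j = x then 0 else 1) fun i => ?_
  fin_cases i
  · exact hx.trans (le_value_of_mem v (by simp [bundle]))
  · exact hy.trans (le_value_of_mem v (by simp [bundle, hxy.symm]))

/-- Separating `x` and `y` shows that the maximin share is at least `t`, which a bundle without both
cannot approximate. -/
lemma mem_of_isApproxMMS {β : ℝ≥0} {v : Profile 2 M} {X : Allocation 2 M}
    (h : IsApproxMMS β 2 v X) (i : Fin 2) {x y : M} (hxy : x ≠ y) {t : ℝ≥0} (hx : t ≤ v i x)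
    (hy : t ≤ v i y) (hbig : β * value (v i) {x, y}ᶜ < t) :
    x ∈ bundle X i ∨ y ∈ bundle X i := by
  by_contra! hne
  have h1 : (t : ℝ) ≤ mms 2 (v i) :=
    le_mms_of_two_items (v i) hxy (by exact_mod_cast hx) (by exact_mod_cast hy)
  have h2 := h.2 i
  rw [div_le_iff₀ h.1] at h2
  have h3 : value (v i) (bundle X i) ≤ value (v i) {x, y}ᶜ := value_mono _ fun j hj => by
    have hjx : j ≠ x := by rintro rfl; exact hne.1 hj
    have hjy : j ≠ y := by rintro rfl; exact hne.2 hj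
    simp [hjx, hjy]
  have h4 := mul_le_mul_of_nonneg_left h3 h.1.le
  linarith

lemma bundle_compl (X : Allocation 2 M) {i k : Fin 2} (hik : i ≠ k) :
    (bundle X i)ᶜ = bundle X k := by
  ext j
  simp only [bundle, Finset.mem_compl, Finset.mem_filter, Finset.mem_univ, true_and]
  omega

/-- Agent `i` reports `u` and every other agent reports `v`. -/
def reports (i : Fin 2) (u v : Valuation M) : Profile 2 M :=
  Function.update (fun _ => v) i u

lemma isRobustDivision_of_mechanism {P : Type*} {X : Mechanism 2 M P} (ht : Truthful X)
    {β : ℝ≥0} (hr : Robust X β 2) (p : P) {i k : Fin 2} (hik : i ≠ k) :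
    IsRobustDivision β fun u v => bundle (X (reports i u v) p) i := by
  have hrep (u v : Valuation M) :
      reports i u v = Function.update (fun _ => u) k v := by
    funext l
    by_cases hl : l = i
    · subst hl; simp [reports, Function.update, hik]
    · have : l = k := by omega
      subst this; simp [reports, Function.update, hl]
  have hk (u v : Valuation M) : reports i u v k = v := by simp [reports, hik.symm]
  have hi (u v : Valuation M) : reports i u v i = u := by simp [reports]
  refine ⟨fun u u' v => ht i _ p u u', fun u v v' => ?_, fun u v x y hxy t hx hy hb => ?_,
    fun u v x y hxy t hx hy hb => ?_⟩
  · simp only [bundle_compl _ hik, hrep]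
    exact ht k _ p v v'
  · exact mem_of_isApproxMMS (hr _ p) i hxy (t := t) (by rwa [hi]) (by rwa [hi]) (by rwa [hi])
  · simp only [← Finset.mem_compl, bundle_compl _ hik]
    exact mem_of_isApproxMMS (hr _ p) k hxy (t := t) (by rwa [hk]) (by rwa [hk]) (by rwa [hk])

/-- Two items that both agents value above all other ones go to different agents. -/
lemma separates_large_items {P : Type*} {X : Mechanism 2 M P} (ht : Truthful X)
    (hr : BoundedRobustness X) (p : P) {v : Valuation M} (hv : ∀ j, 0 < v j) {a b : M}
    (hab : a ≠ b) (hva : ∀ j, j ≠ a → j ≠ b → v j < v a)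
    (hvb : ∀ j, j ≠ a → j ≠ b → v j < v b) :
    X (fun _ => v) p a ≠ X (fun _ => v) p b := by
  intro heq
  obtain ⟨β, hβ⟩ := hr
  lift β to ℝ≥0 using ((hβ (fun _ => v) p).1).le
  obtain ⟨i, hi⟩ : ∃ i, X (fun _ => v) p a = i := ⟨_, rfl⟩
  obtain ⟨k, hik⟩ := exists_ne i
  have hrep : reports i v v = fun _ => v := by simp [reports]
  refine (isRobustDivision_of_mechanism ht hβ p hik.symm).not_both_mem hv hv hab hva hvb ?_ ?_
  · simp [hrep, bundle, hi]
  · simp [hrep, bundle, ← heq, hi]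

/-! ### The critical instance -/

lemma value_bundle_eq_sum (v : Valuation M) (S : Allocation 2 M) (i : Fin 2) :
    value v (bundle S i) = ∑ j, if S j = i then (v j : ℝ) else 0 :=
  Finset.sum_filter _ _

lemma exists_value_witness_le (s : Allocation 2 (Fin 5)) (h : s 0 ≠ s 1) :
    ∃ i, value witness (bundle s i) ≤ 5 / 6 := by
  simp only [value_bundle_eq_sum, Fin.sum_univ_five]
  generalize s 0 = s0 at *
  generalize s 1 = s1 at *
  generalize s 2 = s2
  generalize s 3 = s3
  generalize s 4 = s4
  -- The chosen agent holds at most one of the three items of value 1/3.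
  by_cases hi : (s2 = 0 ∧ s3 = 0) ∨ (s2 = 0 ∧ s4 = 0) ∨ (s3 = 0 ∧ s4 = 0)
  · refine ⟨1, ?_⟩
    fin_cases s0 <;> fin_cases s1 <;> fin_cases s2 <;> fin_cases s3 <;> fin_cases s4 <;>
      simp [witness] at h hi ⊢ <;> norm_num
  · refine ⟨0, ?_⟩
    fin_cases s0 <;> fin_cases s1 <;> fin_cases s2 <;> fin_cases s3 <;> fin_cases s4 <;>
      simp [witness] at h hi ⊢ <;> norm_num

lemma mms_witness : mms 2 witness = 1 := by
  apply le_antisymm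
  · refine ciSup_le fun S => ?_
    have h0 := ciInf_le (f := fun j => value witness (bundle S j))
      (Set.finite_range _).bddBelow 0
    have h1 := ciInf_le (f := fun j => value witness (bundle S j))
      (Set.finite_range _).bddBelow 1
    have h2 := value_add_value_compl witness (bundle S 0)
    rw [bundle_compl S (k := 1) (by decide)] at h2
    have h3 : ∑ j, (witness j : ℝ) = 2 := by
      simp [Fin.sum_univ_five, witness]; norm_num
    linarith
  · refine le_mms witness ![0, 0, 1, 1, 1] fun i => ?_
    rw [value_bundle_eq_sum, Fin.sum_univ_five]
    fin_cases i <;> simp [witness] <;> norm_num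

/-- The critical instance, with further items of value `δ`. -/
noncomputable def paddedWitness (e : Fin 5 ↪ M) (δ : ℝ≥0) : Valuation M :=
  Function.extend e witness fun _ => δ

section paddedWitness

variable (e : Fin 5 ↪ M) {δ : ℝ≥0}

lemma paddedWitness_apply (k : Fin 5) : paddedWitness e δ (e k) = witness k :=
  e.injective.extend_apply _ _ _

lemma paddedWitness_cases {Q : M → ℝ≥0 → Prop} (h : ∀ k, Q (e k) (witness k))
    (h' : ∀ j, (∀ k, e k ≠ j) → Q j δ) (j : M) : Q j (paddedWitness e δ j) := by
  by_cases hj : ∃ k, e k = j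
  · obtain ⟨k, rfl⟩ := hj
    rw [paddedWitness_apply]
    exact h k
  · rw [paddedWitness, Function.extend_apply' _ _ _ hj]
    push Not at hj
    exact h' j hj

lemma map_bundle_comp_subset (S : Allocation 2 M) (i : Fin 2) :
    (bundle (S ∘ e) i).map e ⊆ bundle S i := fun j hj => by
  obtain ⟨k, hk, rfl⟩ := Finset.mem_map.1 hj
  simpa [bundle] using hk

lemma value_paddedWitness_map (T : Finset (Fin 5)) :
    value (paddedWitness e δ) (T.map e) = value witness T := by
  simp [value, paddedWitness_apply]

lemma value_witness_le (S : Allocation 2 M) (i : Fin 2) :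
    value witness (bundle (S ∘ e) i) ≤ value (paddedWitness e δ) (bundle S i) := by
  rw [← value_paddedWitness_map e]
  exact value_mono _ (map_bundle_comp_subset e S i)

lemma value_paddedWitness_le (S : Allocation 2 M) (i : Fin 2) :
    value (paddedWitness e δ) (bundle S i) ≤
      value witness (bundle (S ∘ e) i) + Fintype.card M * δ := by
  have h2 : value (paddedWitness e δ) (bundle S i \ (bundle (S ∘ e) i).map e) ≤
      (bundle S i \ (bundle (S ∘ e) i).map e).card • (δ : ℝ) :=
    Finset.sum_le_card_nsmul _ _ _ fun j hj => by
      rw [Finset.mem_sdiff] at hj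
      have hj' : ¬ ∃ k, e k = j := by
        rintro ⟨k, rfl⟩
        exact hj.2 (Finset.mem_map_of_mem e (by simpa [bundle] using hj.1))
      rw [paddedWitness, Function.extend_apply' _ _ _ hj']
  have h3 : value (paddedWitness e δ) (bundle S i \ (bundle (S ∘ e) i).map e)
      + value (paddedWitness e δ) ((bundle (S ∘ e) i).map e)
      = value (paddedWitness e δ) (bundle S i) :=
    Finset.sum_sdiff (map_bundle_comp_subset e S i)
  rw [value_paddedWitness_map] at h3
  rw [nsmul_eq_mul] at h2
  have h4 : ((bundle S i \ (bundle (S ∘ e) i).map e).card : ℝ) * δ ≤ Fintype.card M * δ := by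
    gcongr
    exact Finset.card_le_univ _
  linarith

lemma one_le_mms_paddedWitness : 1 ≤ mms 2 (paddedWitness e δ) := by
  refine le_mms _ (Function.extend e ![0, 0, 1, 1, 1] fun _ => 0) fun i =>
    le_trans ?_ (value_witness_le e _ i)
  rw [Function.extend_comp e.injective, value_bundle_eq_sum, Fin.sum_univ_five]
  fin_cases i <;> simp [witness] <;> norm_num

lemma exists_value_paddedWitness_le {P : Type*} {X : Mechanism 2 M P} (ht : Truthful X)
    (hr : BoundedRobustness X) (p : P) (hδ : 0 < δ) (hδ' : δ < 1 / 2) :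
    X (fun _ => paddedWitness e δ) p (e 0) ≠ X (fun _ => paddedWitness e δ) p (e 1) ∧
    ∃ i, value (paddedWitness e δ) (bundle (X (fun _ => paddedWitness e δ) p) i) ≤
      5 / 6 + Fintype.card M * δ := by
  have hpos : ∀ j, 0 < paddedWitness e δ j :=
    paddedWitness_cases e (Q := fun _ t => 0 < t)
      (fun k => by fin_cases k <;> simp [witness]) fun _ _ => hδ
  have hlt : ∀ j, j ≠ e 0 → j ≠ e 1 → paddedWitness e δ j < 1 / 2 :=
    paddedWitness_cases e (Q := fun j t => j ≠ e 0 → j ≠ e 1 → t < 1 / 2)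
      (fun k h0 h1 => by
        fin_cases k
        · exact absurd rfl h0
        · exact absurd rfl h1
        all_goals
          simp only [witness]
          rw [← NNReal.coe_lt_coe]
          simp
          norm_num) fun _ _ _ _ => hδ'
  have hsep := separates_large_items ht hr p hpos (a := e 0) (b := e 1) (by simp)
    (by rw [paddedWitness_apply]; exact hlt) (by rw [paddedWitness_apply]; exact hlt)
  obtain ⟨i, hi⟩ := exists_value_witness_le (X (fun _ => paddedWitness e δ) p ∘ e) hsep
  exact ⟨hsep, i, (value_paddedWitness_le e _ i).trans (by gcongr)⟩

end paddedWitness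

end MMS

theorem mainTheorem4 {M P : Type*} [Fintype M] :
    -- no truthful mechanism with consistency `6/5 - ε` and bounded robustness,
    -- for any prediction space, prediction function and any number `m ≥ 5` of items
    (5 ≤ Fintype.card M → ∀ ε : ℝ, 0 < ε →
      ¬ ∃ (X : MMS.Mechanism 2 M P) (f : MMS.Profile 2 M → P),
          MMS.Truthful X ∧ MMS.Consistent X f (6 / 5 - ε) ∧ MMS.BoundedRobustness X) ∧
    -- the witness: both maximin shares are 1, the two large items are split,
    -- and some agent gets at most 5/6
    (MMS.mms 2 MMS.witness = 1 ∧
      ∀ X : MMS.Mechanism 2 (Fin 5) P, MMS.Truthful X → MMS.BoundedRobustness X →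
        ∀ p : P,
          X (fun _ => MMS.witness) p 0 ≠ X (fun _ => MMS.witness) p 1 ∧
          ∃ i : Fin 2,
            MMS.value MMS.witness (MMS.bundle (X (fun _ => MMS.witness) p) i) ≤ 5 / 6) := by
  classical
  refine ⟨?_, MMS.mms_witness, fun X ht hr p => ?_⟩
  · rintro hM ε hε ⟨X, f, ht, hc, hr⟩
    obtain ⟨e⟩ : Nonempty (Fin 5 ↪ M) :=
      Function.Embedding.nonempty_of_card_le (by simpa using hM)
    -- Positivity of the factor is part of consistency, at any profile.
    have hα : 0 < 6 / 5 - ε := (hc fun _ => 0).1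
    have hgap : 0 < 1 / (6 / 5 - ε) - 5 / 6 := by
      rw [sub_pos, lt_div_iff₀ hα]
      linarith
    have hm : (0 : ℝ) < Fintype.card M := by exact_mod_cast (by omega : 0 < Fintype.card M)
    -- The padding must leave 5/6 plus its total below `1 / (6 / 5 - ε)`, and stay below the large
    -- items.
    obtain ⟨δ, hδ, hδ'⟩ : ∃ δ : ℝ, 0 < δ ∧
        δ < min (1 / 2) ((1 / (6 / 5 - ε) - 5 / 6) / Fintype.card M) :=
      exists_between (lt_min (by norm_num) (div_pos hgap hm))
    rw [lt_min_iff, lt_div_iff₀ hm] at hδ'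
    lift δ to ℝ≥0 using hδ.le
    obtain ⟨-, i, hi⟩ := MMS.exists_value_paddedWitness_le e ht hr
      (f fun _ => MMS.paddedWitness e δ) (by exact_mod_cast hδ)
      (by rw [← NNReal.coe_lt_coe]; simpa using hδ'.1)
    have h1 := (hc fun _ => MMS.paddedWitness e δ).2 i
    have h2 := div_le_div_of_nonneg_right (MMS.one_le_mms_paddedWitness e (δ := δ)) hα.le
    linarith
  · have hsep : X (fun _ => MMS.witness) p 0 ≠ X (fun _ => MMS.witness) p 1 := by
      -- With five items nothing is padded, so 1/4 is an arbitrary value in (0, 1/2).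
      have he : MMS.paddedWitness (Function.Embedding.refl (Fin 5)) (1 / 4) = MMS.witness :=
        funext fun k => MMS.paddedWitness_apply (Function.Embedding.refl (Fin 5)) k
      have := (MMS.exists_value_paddedWitness_le (Function.Embedding.refl (Fin 5)) ht hr p
        (δ := 1 / 4) (by norm_num) (by rw [← NNReal.coe_lt_coe]; norm_num)).1
      rwa [he] at this
    exact ⟨hsep, MMS.exists_value_witness_le _ hsep⟩
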